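/- Let $n\ge 0$ be an integer, let $0<\alpha<1$, let $\mathbb D=\{z\in\mathbb C: |z|<1\}$, let $\mathbb D'$ be a closed disk of positive radius (not necessarily concentric) contained in $\mathbb D$, and let $\Lambda\in\mathbb R$. Then there is a constant $C_\alpha>0$, depending only on $n$, $\alpha$, $\mathbb D'$ and $\Lambda$, with the following property. Let $J$ be a smooth almost complex structure on $\mathbb R^{2n}$, i.e. a $C^\infty$ map $w\mapsto J_w\in \mathrm{End}(\mathbb R^{2n})$ with $J_w^2=-1$ for all $w$, and let $f:\mathbb D\to(\mathbb R^{2n},J)$ be a pseudo-holomorphic map, i.e. a $C^1$ map with $Df(z)(iv)=J_{f(z)}\,Df(z)(v)$ for all $z\in\mathbb D$ and $v\in\mathbb C$. Assume that $|J|\le\Lambda$ and $|DJ|\le\Lambda$ at every point of $f(\mathbb D)$. Then $$|Df|_{C^\alpha(\mathbb D')}\;\le\; C_\alpha\,\sup_{z\in\mathbb D}\bigl(|Df(z)|+|Df(z)|^2\bigr),$$ where $|g|_{C^\alpha(\mathbb D')}=\sup_{\mathbb D'}|g|+\sup_{z_1\ne z_2\in\mathbb D'}\frac{|g(z_1)-g(z_2)|}{|z_1-z_2|^\alpha}$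 is the full Hölder norm (so in particular the Hölder seminorm of $Df$ on $\mathbb D'$ satisfies the same bound), all norms of linear maps are operator norms for the Euclidean norms, and the estimate is understood in $[0,\infty]$ (the right-hand side may be $+\infty$). In particular, for a fixed $J$ and a fixed compact set $K\subset\mathbb R^{2n}$, one constant $C_\alpha$ serves all pseudo-holomorphic $f$ with $f(\mathbb D)\subset K$. -/

import Mathlib

open scoped NNReal ENNReal ContDiff

/-- A smooth almost complex structure on `ℝ^{2n}`: a smooth field `w ↦ J w` of endomorphisms of
`T_w ℝ^{2n} = ℝ^{2n}` with `(J w)² = -1`. -/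
structure IsAlmostComplexStructure {n : ℕ}
    (J : EuclideanSpace ℝ (Fin (2 * n)) →
      (EuclideanSpace ℝ (Fin (2 * n)) →L[ℝ] EuclideanSpace ℝ (Fin (2 * n)))) : Prop where
  smooth : ContDiff ℝ ∞ J
  sq_eq_neg : ∀ w v, J w (J w v) = -v

/-- `f` is a pseudo-holomorphic map from the open set `U ⊆ ℂ` to `(ℝ^{2n}, J)`: it is of class
`C¹` on `U` and its differential intertwines multiplication by `i` on `ℂ` with `J`. -/
structure IsPseudoHolomorphicOn {n : ℕ}
    (J : EuclideanSpace ℝ (Fin (2 * n)) →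
      (EuclideanSpace ℝ (Fin (2 * n)) →L[ℝ] EuclideanSpace ℝ (Fin (2 * n))))
    (f : ℂ → EuclideanSpace ℝ (Fin (2 * n))) (U : Set ℂ) : Prop where
  contDiffOn : ContDiffOn ℝ 1 f U
  fderiv_I_mul : ∀ z ∈ U, ∀ v : ℂ,
    fderiv ℝ f z (Complex.I * v) = J (f z) (fderiv ℝ f z v)

/-- The full Hölder norm `|g|_{C^α(S)} = sup_S |g| + [g]_{C^α(S)}`, with values in `[0, ∞]`.
The second summand is the Hölder seminorm, the least `K` with
`|g(z₁) - g(z₂)| ≤ K |z₁ - z₂|^α` for all `z₁, z₂ ∈ S`. -/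
noncomputable def holderNormOn {F : Type*} [NormedAddCommGroup F]
    (α : ℝ≥0) (g : ℂ → F) (S : Set ℂ) : ℝ≥0∞ :=
  (⨆ z ∈ S, ‖g z‖ₑ) + eHolderNorm α (S.domRestrict g)

/-! Freeze the structure at one value of `f`. With `J₀ = J (f z₀)`, the map `f` is nearly
`J₀`-holomorphic near `z₀`: its `J₀`-Cauchy-Riemann defect is controlled by `‖J (f w) - J₀‖ * ‖Df
w‖`, which is at most a multiple of `M ^ 2 * ‖w - z₀‖` when `‖Df‖ ≤ M`. Cutting off `f - f z₀` by a
bump adds an error of order `M * ‖w - z₀‖`. These two terms are the source of `|Df| + |Df|²`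
(`exists_taylor_bound`).

A defect vanishing linearly at `z₀` can be integrated against the first-order Taylor remainder in
`z` of the Cauchy kernel `(w - z)⁻¹`. The resulting integrand is `O(|z - z₀|² / (|w - z| |w -
z₀|))`, which interpolates to `|z - z₀| ^ (1 + α)` times integrable singularities. Hence `f` has a
`C^{1,α}` Taylor expansion at `z₀`, uniformly in `z₀` (`norm_sub_fderiv_le`). Comparing the
expansions at two points bounds the oscillation of `Df` (`norm_fderiv_sub_le_of_taylor`). No second
derivative of `f` is ever used. -/

open MeasureTheory Set Filter Topology

/-! ### Cauchy-Pompeiu formula for a constant complex structure. -/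

section Kernel

variable {E : Type*} [NormedAddCommGroup E] [NormedSpace ℝ E]

/-- Multiplication by the complex number `ζ` for the complex structure `J`. -/
def complexAct (J : E →L[ℝ] E) (ζ : ℂ) : E →L[ℝ] E :=
  ζ.re • ContinuousLinearMap.id ℝ E + ζ.im • J

theorem complexAct_apply (J : E →L[ℝ] E) (ζ : ℂ) (v : E) :
    complexAct J ζ v = ζ.re • v + ζ.im • J v := rfl

theorem complexAct_sub (J : E →L[ℝ] E) (ζ ξ : ℂ) (v : E) :
    complexAct J (ζ - ξ) v = complexAct J ζ v - complexAct J ξ v := by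
  simp only [complexAct_apply, Complex.sub_re, Complex.sub_im]
  module

theorem complexAct_mul {J : E →L[ℝ] E} (hJ : ∀ v, J (J v) = -v) (ζ ξ : ℂ) (v : E) :
    complexAct J (ζ * ξ) v = complexAct J ζ (complexAct J ξ v) := by
  simp only [complexAct_apply, Complex.mul_re, Complex.mul_im, map_add, map_smul, hJ]
  module

theorem norm_complexAct_le (J : E →L[ℝ] E) (ζ : ℂ) (v : E) :
    ‖complexAct J ζ v‖ ≤ (1 + ‖J‖) * (‖ζ‖ * ‖v‖) := by
  rw [complexAct_apply]
  have h1 : ‖ζ.re • v‖ ≤ ‖ζ‖ * ‖v‖ := by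
    rw [norm_smul]; gcongr; exact Complex.abs_re_le_norm ζ
  have h2 : ‖ζ.im • J v‖ ≤ ‖ζ‖ * (‖J‖ * ‖v‖) := by
    rw [norm_smul]; gcongr
    · exact Complex.abs_im_le_norm ζ
    · exact J.le_opNorm v
  calc _ ≤ _ := norm_add_le_of_le h1 h2
    _ = _ := by ring

/-- Twice the Cauchy-Riemann operator of the complex structure `J`. -/
noncomputable def dbarOp (J : E →L[ℝ] E) (h : ℂ → E) (w : ℂ) : E :=
  fderiv ℝ h w 1 + J (fderiv ℝ h w Complex.I)

/-- The Cauchy-Riemann operator is equivariant under rotation of the frame `(1, i)`. In polar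
coordinates it thus splits into a radial derivative plus `J` of an angular one. -/
theorem complexAct_conj_dbarOp {J : E →L[ℝ] E} (hJ : ∀ v, J (J v) = -v) (h : ℂ → E) (w : ℂ)
    (θ : ℝ) :
    complexAct J (Real.cos θ + Real.sin θ * Complex.I)⁻¹ (dbarOp J h w) =
      fderiv ℝ h w (Real.cos θ + Real.sin θ * Complex.I) +
        J (fderiv ℝ h w ((Real.cos θ + Real.sin θ * Complex.I) * Complex.I)) := by
  have hinv : ((Real.cos θ : ℂ) + Real.sin θ * Complex.I)⁻¹ =
      Real.cos θ - Real.sin θ * Complex.I := by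
    apply inv_eq_of_mul_eq_one_right
    have := Complex.sin_sq_add_cos_sq (θ : ℂ)
    push_cast
    ring_nf
    rw [Complex.I_sq]
    linear_combination this
  have e1 : (Real.cos θ + Real.sin θ * Complex.I : ℂ) =
      Real.cos θ • (1 : ℂ) + Real.sin θ • Complex.I := by simp
  have e2 : (Real.cos θ + Real.sin θ * Complex.I : ℂ) * Complex.I =
      Real.cos θ • Complex.I + (-Real.sin θ) • (1 : ℂ) := by
    simp only [Complex.real_smul]
    push_cast
    linear_combination (Complex.sin θ : ℂ) * Complex.I_mul_I
  have hre : ((Real.cos θ : ℂ) - Real.sin θ * Complex.I).re = Real.cos θ := by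
    simp [-Complex.ofReal_cos, -Complex.ofReal_sin]
  have him : ((Real.cos θ : ℂ) - Real.sin θ * Complex.I).im = -Real.sin θ := by
    simp [-Complex.ofReal_cos, -Complex.ofReal_sin]
  rw [hinv, e2, e1, complexAct_apply, hre, him, dbarOp]
  simp only [map_add, map_smul, hJ]
  module

theorem continuous_dbarOp (J : E →L[ℝ] E) {h : ℂ → E} (hh : ContDiff ℝ 1 h) :
    Continuous (dbarOp J h) := by
  have := hh.continuous_fderiv one_ne_zero
  unfold dbarOp
  fun_prop

theorem dbarOp_eq_zero_of_notMem_tsupport (J : E →L[ℝ] E) {h : ℂ → E} {w : ℂ}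
    (hw : w ∉ tsupport h) : dbarOp J h w = 0 := by
  have : fderiv ℝ h w = 0 := by
    have := support_fderiv_subset ℝ (f := h)
    by_contra h0
    exact hw (this h0)
  simp [dbarOp, this]

theorem integrableOn_polarCoord_target {F : Type*} [NormedAddCommGroup F]
    {G : ℝ × ℝ → F} (hG : Continuous G) {R : ℝ} (hR : ∀ p : ℝ × ℝ, R ≤ p.1 → G p = 0) :
    IntegrableOn G (Ioi (0 : ℝ) ×ˢ Ioo (-Real.pi) Real.pi) := by
  have h1 : IntegrableOn G (Icc (0 : ℝ) R ×ˢ Icc (-Real.pi) Real.pi) :=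
    hG.continuousOn.integrableOn_compact (isCompact_Icc.prod isCompact_Icc)
  refine h1.of_forall_sdiff_eq_zero (measurableSet_Ioi.prod measurableSet_Ioo) ?_
  rintro ⟨r, θ⟩ ⟨⟨hr, hθ⟩, hn⟩
  apply hR
  by_contra hlt
  exact hn ⟨⟨le_of_lt hr, (not_le.mp hlt).le⟩, Ioo_subset_Icc_self hθ⟩

variable [CompleteSpace E]

theorem integral_polar_radial {h : ℂ → E} (hh : ContDiff ℝ 1 h) {R : ℝ}
    (hR : ∀ w : ℂ, R ≤ ‖w‖ → h w = 0) (u : ℂ) (hu : ‖u‖ = 1) :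
    ∫ r in Ioi (0 : ℝ), fderiv ℝ h (r * u) u = -h 0 := by
  have hg : ContDiff ℝ 1 (fun r : ℝ => h (r * u)) :=
    hh.comp (Complex.ofRealCLM.contDiff.mul contDiff_const)
  have hd (r : ℝ) : deriv (fun r : ℝ => h (r * u)) r = fderiv ℝ h (r * u) u := by
    have h1 : HasDerivAt (fun r : ℝ => (r : ℂ) * u) (1 * u) r :=
      (Complex.ofRealCLM.hasDerivAt (x := r)).mul_const u
    have h2 := (hh.differentiable one_ne_zero (r * u)).hasFDerivAt.comp_hasDerivAt r h1
    rw [one_mul] at h2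
    exact h2.deriv
  have hc : HasCompactSupport (fun r : ℝ => h (r * u)) := by
    refine HasCompactSupport.intro (isCompact_Icc (a := -R) (b := R)) fun r hr => hR _ ?_
    rw [norm_mul, hu, mul_one, Complex.norm_real, Real.norm_eq_abs]
    by_contra hlt
    exact hr (abs_le.mp (not_le.mp hlt).le)
  simpa [hd] using hc.integral_Ioi_deriv_eq hg 0

theorem integral_polar_angular {h : ℂ → E} (hh : ContDiff ℝ 1 h) {r : ℝ} (hr : 0 < r) :
    ∫ θ in Ioo (-Real.pi) Real.pi, fderiv ℝ h (r * (Real.cos θ + Real.sin θ * Complex.I))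
      ((Real.cos θ + Real.sin θ * Complex.I) * Complex.I) = 0 := by
  have h1 (θ : ℝ) : HasDerivAt (fun θ : ℝ => (r : ℂ) * (Real.cos θ + Real.sin θ * Complex.I))
      (r • ((Real.cos θ + Real.sin θ * Complex.I) * Complex.I)) θ := by
    have hc := (Real.hasDerivAt_cos θ).ofReal_comp
    have hs := (Real.hasDerivAt_sin θ).ofReal_comp
    refine ((hc.add (hs.mul_const Complex.I)).const_mul (r : ℂ)).congr_deriv ?_
    rw [Complex.real_smul]
    push_cast
    linear_combination -(r : ℂ) * Complex.sin θ * Complex.I_mul_I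
  have h2 (θ : ℝ) := (hh.differentiable one_ne_zero
    (r * (Real.cos θ + Real.sin θ * Complex.I))).hasFDerivAt.comp_hasDerivAt θ (h1 θ)
  have h3 (θ : ℝ) : HasDerivAt
      (fun θ : ℝ => r⁻¹ • h ((r : ℂ) * (Real.cos θ + Real.sin θ * Complex.I)))
      (fderiv ℝ h (r * (Real.cos θ + Real.sin θ * Complex.I))
        ((Real.cos θ + Real.sin θ * Complex.I) * Complex.I)) θ := by
    refine ((h2 θ).const_smul r⁻¹).congr_deriv ?_
    rw [map_smul, smul_smul, inv_mul_cancel₀ hr.ne', one_smul]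
  have hfd := hh.continuous_fderiv one_ne_zero
  rw [← integral_Ioc_eq_integral_Ioo,
    ← intervalIntegral.integral_of_le (by linarith [Real.pi_pos]),
    intervalIntegral.integral_eq_sub_of_hasDerivAt (fun θ _ => h3 θ)]
  · simp
  · apply Continuous.intervalIntegrable
    fun_prop

/-- The Cauchy-Pompeiu formula at the origin for a compactly supported `C¹` map with values in a
real vector space with complex structure `J`. -/
theorem integral_complexAct_inv_dbarOp_zero {J : E →L[ℝ] E} (hJ : ∀ v, J (J v) = -v) {h : ℂ → E}
    (hh : ContDiff ℝ 1 h) (hs : HasCompactSupport h) :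
    ∫ w, complexAct J w⁻¹ (dbarOp J h w) = -((2 * Real.pi) • h 0) := by
  obtain ⟨R, -, hR⟩ := hs.isCompact.isBounded.exists_pos_norm_lt
  have hR' (w : ℂ) (hw : R ≤ ‖w‖) : w ∉ tsupport h := fun hm => (hR w hm).not_ge hw
  have hfd0 (w : ℂ) (hw : R ≤ ‖w‖) : fderiv ℝ h w = 0 := by
    by_contra h0
    exact hR' w hw (support_fderiv_subset ℝ h0)
  have hfd := hh.continuous_fderiv one_ne_zero
  set A : ℝ × ℝ → E := fun p => fderiv ℝ h (p.1 * (Real.cos p.2 + Real.sin p.2 * Complex.I))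
    (Real.cos p.2 + Real.sin p.2 * Complex.I) with hA
  set B : ℝ × ℝ → E := fun p => fderiv ℝ h (p.1 * (Real.cos p.2 + Real.sin p.2 * Complex.I))
    ((Real.cos p.2 + Real.sin p.2 * Complex.I) * Complex.I) with hB
  have hunit (θ : ℝ) : ‖(Real.cos θ + Real.sin θ * Complex.I : ℂ)‖ = 1 := by
    simp
  have hzero (p : ℝ × ℝ) (hp : R ≤ p.1) :
      fderiv ℝ h (p.1 * (Real.cos p.2 + Real.sin p.2 * Complex.I)) = 0 := by
    apply hfd0
    rw [norm_mul, hunit, mul_one, Complex.norm_real]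
    exact hp.trans (le_abs_self _)
  have hAi : IntegrableOn A (Ioi (0 : ℝ) ×ˢ Ioo (-Real.pi) Real.pi) :=
    integrableOn_polarCoord_target (by fun_prop) (R := R) fun p hp => by
      simp only [hA, hzero p hp]
      simp
  have hBi : IntegrableOn B (Ioi (0 : ℝ) ×ˢ Ioo (-Real.pi) Real.pi) :=
    integrableOn_polarCoord_target (by fun_prop) (R := R) fun p hp => by
      simp only [hB, hzero p hp]
      simp
  rw [← Complex.integral_comp_polarCoord_symm]
  -- The Jacobian `r` cancels the singularity of the kernel. What remains integrates to the boundary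
  -- value at `0` along rays (`A`) and to zero over circles (`B`).
  have e : ∀ p ∈ polarCoord.target, p.1 • complexAct J (Complex.polarCoord.symm p)⁻¹
      (dbarOp J h (Complex.polarCoord.symm p)) = A p + J (B p) := by
    rintro ⟨r, θ⟩ ⟨hr, -⟩
    have hr : r ≠ 0 := (show (0 : ℝ) < r from hr).ne'
    have hm : complexAct J (r : ℂ)⁻¹ = r⁻¹ • ContinuousLinearMap.id ℝ E := by
      rw [← Complex.ofReal_inv, complexAct]
      simp
    rw [Complex.polarCoord_symm_apply, mul_inv, complexAct_mul hJ, complexAct_conj_dbarOp hJ, hm]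
    simp only [smul_apply, ContinuousLinearMap.id_apply, smul_smul,
      mul_inv_cancel₀ hr, one_smul, hA, hB]
  rw [setIntegral_congr_fun polarCoord.open_target.measurableSet e]
  change ∫ p in Ioi (0 : ℝ) ×ˢ Ioo (-Real.pi) Real.pi, A p + J (B p) = _
  rw [integral_add hAi (J.integrable_comp hBi), J.integral_comp_comm hBi]
  have hBz : ∫ p in Ioi (0 : ℝ) ×ˢ Ioo (-Real.pi) Real.pi, B p = 0 := by
    rw [Measure.volume_eq_prod, setIntegral_prod _ hBi]
    rw [setIntegral_congr_fun measurableSet_Ioi fun r hr => integral_polar_angular hh hr]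
    simp
  have hAz : ∫ p in Ioi (0 : ℝ) ×ˢ Ioo (-Real.pi) Real.pi, A p = -((2 * Real.pi) • h 0) := by
    rw [Measure.volume_eq_prod, ← Measure.prod_restrict, integral_prod_symm _ (by
      rwa [Measure.prod_restrict, ← Measure.volume_eq_prod])]
    have (θ : ℝ) : ∫ r in Ioi (0 : ℝ), A (r, θ) = -h 0 :=
      integral_polar_radial hh (fun w hw => image_eq_zero_of_notMem_tsupport (hR' w hw)) _ (hunit θ)
    simp only [this]
    rw [setIntegral_const, Real.volume_real_Ioo_of_le (by linarith [Real.pi_pos]), smul_neg]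
    congr 2
    ring
  rw [hBz, hAz]
  simp

/-- The Cauchy-Pompeiu formula for a compactly supported `C¹` map with values in a real vector
space with complex structure `J`. -/
theorem integral_complexAct_inv_sub_dbarOp {J : E →L[ℝ] E} (hJ : ∀ v, J (J v) = -v) {h : ℂ → E}
    (hh : ContDiff ℝ 1 h) (hs : HasCompactSupport h) (z : ℂ) :
    ∫ w, complexAct J (w - z)⁻¹ (dbarOp J h w) = -((2 * Real.pi) • h z) := by
  have h1 := integral_complexAct_inv_dbarOp_zero hJ (h := fun w => h (w + z))
    (hh.comp (contDiff_id.add contDiff_const)) (hs.comp_homeomorph (Homeomorph.addRight z))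
  rw [zero_add] at h1
  rw [← h1, ← integral_add_right_eq_self _ z]
  simp [dbarOp, fderiv_comp_add_right]

end Kernel

/-! ### Taylor remainder of the Cauchy integral. -/

section Singular

/-- The weakly singular kernel `|x| ^ (-(1 + α))` on `ℂ`, truncated to the disk of radius `2`. -/
noncomputable def truncatedKernel (α : ℝ) : ℂ → ℝ :=
  (Metric.ball (0 : ℂ) 2).indicator fun x => ‖x‖ ^ (-(1 + α))

theorem truncatedKernel_nonneg (α : ℝ) (x : ℂ) : 0 ≤ truncatedKernel α x :=
  indicator_nonneg (fun _ _ => by positivity) x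

theorem truncatedKernel_sub (α : ℝ) {w z : ℂ} (hw : w ∈ Metric.ball (0 : ℂ) 1)
    (hz : z ∈ Metric.ball (0 : ℂ) 1) : truncatedKernel α (w - z) = ‖w - z‖ ^ (-(1 + α)) := by
  refine indicator_of_mem ?_ _
  rw [mem_ball_zero_iff] at *
  linarith [norm_sub_le w z]

theorem integrable_truncatedKernel {α : ℝ} (hα₁ : α < 1) : Integrable (truncatedKernel α) := by
  refine (integrable_indicator_iff Metric.isOpen_ball.measurableSet).mpr ?_
  refine integrableOn_ball_of_norm_le_rpow (C := 1) (α := 1 + α) ?_ ?_ ?_ ?_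
  · simp
  · rw [Complex.finrank_real_complex]
    push_cast
    linarith
  · refine ae_of_all _ fun x => ?_
    rw [one_mul, Real.norm_of_nonneg (by positivity)]
  · exact (measurable_norm.pow_const _).aestronglyMeasurable

/-- Split `d ^ 2 = d ^ (1 + α) * d ^ (1 - α)`. Since `d ≤ 2 * b`, the second factor is absorbed by
`b`, and the leftover `b ^ (-α)` is at most `a ^ (-α)`. -/
theorem sq_div_mul_le_of_le {α a b d : ℝ} (hα₀ : 0 < α) (hα₁ : α < 1) (ha : 0 < a) (hab : a ≤ b)
    (hd : 0 ≤ d) (h : d ≤ a + b) :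
    d ^ 2 / (a * b) ≤ 2 * d ^ (1 + α) * a ^ (-(1 + α)) := by
  have hb : 0 < b := ha.trans_le hab
  have h1 : d ^ 2 = d ^ (1 + α) * d ^ (1 - α) := by
    rw [← Real.rpow_add_of_nonneg hd (by linarith) (by linarith), ← Real.rpow_natCast]
    norm_num
  have h2 : d ^ (1 - α) ≤ 2 * b ^ (1 - α) := by
    calc d ^ (1 - α) ≤ (2 * b) ^ (1 - α) := Real.rpow_le_rpow hd (by linarith) (by linarith)
      _ = 2 ^ (1 - α) * b ^ (1 - α) := Real.mul_rpow (by norm_num) hb.le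
      _ ≤ 2 * b ^ (1 - α) := by
        gcongr
        calc (2 : ℝ) ^ (1 - α) ≤ 2 ^ (1 : ℝ) := by gcongr <;> linarith
          _ = 2 := Real.rpow_one 2
  have h3 : b ^ (1 - α) / b = b ^ (-α) := by
    rw [← Real.rpow_sub_one hb.ne']
    ring_nf
  have h4 : b ^ (-α) ≤ a ^ (-α) := Real.rpow_le_rpow_of_nonpos ha hab (by linarith)
  have h5 : a ^ (-α) / a = a ^ (-(1 + α)) := by
    rw [← Real.rpow_sub_one ha.ne']
    ring_nf
  calc d ^ 2 / (a * b) ≤ d ^ (1 + α) * (2 * b ^ (1 - α)) / (a * b) := by rw [h1]; gcongr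
    _ = 2 * d ^ (1 + α) * ((b ^ (1 - α) / b) / a) := by field_simp
    _ ≤ 2 * d ^ (1 + α) * (a ^ (-α) / a) := by rw [h3]; gcongr
    _ = _ := by rw [h5]

theorem sq_div_mul_le {α a b d : ℝ} (hα₀ : 0 < α) (hα₁ : α < 1) (ha : 0 < a) (hb : 0 < b)
    (hd : 0 ≤ d) (h : d ≤ a + b) :
    d ^ 2 / (a * b) ≤ 2 * d ^ (1 + α) * (a ^ (-(1 + α)) + b ^ (-(1 + α))) := by
  have h1 : 0 ≤ 2 * d ^ (1 + α) * b ^ (-(1 + α)) := by positivity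
  have h2 : 0 ≤ 2 * d ^ (1 + α) * a ^ (-(1 + α)) := by positivity
  rcases le_total a b with hab | hab
  · linarith [sq_div_mul_le_of_le hα₀ hα₁ ha hab hd h]
  · have := sq_div_mul_le_of_le hα₀ hα₁ hb hab hd (by linarith)
    rw [mul_comm b a] at this
    linarith

theorem inv_norm_le_rpow {α : ℝ} (hα₀ : 0 < α) {x : ℂ} (hx : ‖x‖ < 2) :
    ‖x‖⁻¹ ≤ 2 ^ α * ‖x‖ ^ (-(1 + α)) := by
  rcases eq_or_ne x 0 with rfl | h0
  · simp only [norm_zero, inv_zero]; positivity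
  have hp : 0 < ‖x‖ := norm_pos_iff.mpr h0
  have e : ‖x‖⁻¹ = ‖x‖ ^ α * ‖x‖ ^ (-(1 + α)) := by
    rw [← Real.rpow_add hp, ← Real.rpow_neg_one]
    ring_nf
  rw [e]
  gcongr

variable {E : Type*} [NormedAddCommGroup E] [NormedSpace ℝ E]

theorem aestronglyMeasurable_complexAct (J : E →L[ℝ] E) {k : ℂ → ℂ} (hk : Measurable k)
    {e : ℂ → E} (he : Continuous e) :
    AEStronglyMeasurable (fun w => complexAct J (k w) (e w)) volume := by
  simp only [complexAct_apply]
  refine AEStronglyMeasurable.add ?_ ?_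
  · exact (Complex.measurable_re.comp hk).aestronglyMeasurable.smul he.aestronglyMeasurable
  · exact (Complex.measurable_im.comp hk).aestronglyMeasurable.smul
      (J.continuous.comp he).aestronglyMeasurable

theorem integrable_complexAct_of_norm_le {α : ℝ} (hα₀ : 0 < α) (hα₁ : α < 1) (J : E →L[ℝ] E)
    {k : ℂ → ℂ} (hk : Measurable k) {e : ℂ → E} (he : Continuous e)
    (hsupp : ∀ w, w ∉ Metric.ball (0 : ℂ) 1 → e w = 0) {z : ℂ} (hz : z ∈ Metric.ball (0 : ℂ) 1)
    {B : ℝ} (hB : ∀ w ∈ Metric.ball (0 : ℂ) 1, ‖k w‖ * ‖e w‖ ≤ B * ‖w - z‖⁻¹) (hB0 : 0 ≤ B) :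
    Integrable (fun w => complexAct J (k w) (e w)) := by
  have hi : Integrable (fun w => (1 + ‖J‖) * (B * 2 ^ α) * truncatedKernel α (w - z)) :=
    ((integrable_truncatedKernel hα₁).comp_sub_right z).const_mul _
  refine hi.mono' (aestronglyMeasurable_complexAct J hk he) (ae_of_all _ fun w => ?_)
  by_cases hw : w ∈ Metric.ball (0 : ℂ) 1
  · have h2 : ‖w - z‖ < 2 := by
      rw [mem_ball_zero_iff] at *
      linarith [norm_sub_le w z]
    rw [truncatedKernel_sub α hw hz]
    calc _ ≤ (1 + ‖J‖) * (‖k w‖ * ‖e w‖) := norm_complexAct_le J _ _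
      _ ≤ (1 + ‖J‖) * (B * (2 ^ α * ‖w - z‖ ^ (-(1 + α)))) := by
        refine mul_le_mul_of_nonneg_left ((hB w hw).trans ?_) (by positivity)
        gcongr
        exact inv_norm_le_rpow hα₀ h2
      _ = _ := by ring
  · rw [hsupp w hw, map_zero, norm_zero]
    have := truncatedKernel_nonneg α (w - z)
    positivity

theorem norm_complexAct_kernel_le {α : ℝ} (hα₀ : 0 < α) (hα₁ : α < 1) {J : E →L[ℝ] E}
    {z z₀ w : ℂ} (hz : z ∈ Metric.ball (0 : ℂ) 1) (hz₀ : z₀ ∈ Metric.ball (0 : ℂ) 1)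
    (hwz : w ≠ z) (hwz₀ : w ≠ z₀) {v : E} {K : ℝ}
    (hv : ‖v‖ ≤ K * ‖w - z₀‖) (hK : 0 ≤ K)
    (hsupp : w ∉ Metric.ball (0 : ℂ) 1 → v = 0) :
    ‖complexAct J ((w - z)⁻¹ - (w - z₀)⁻¹ - (z - z₀) * (w - z₀)⁻¹ ^ 2) v‖ ≤
      2 * (1 + ‖J‖) * K * ‖z - z₀‖ ^ (1 + α) *
        (truncatedKernel α (w - z) + truncatedKernel α (w - z₀)) := by
  by_cases hw : w ∈ Metric.ball (0 : ℂ) 1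
  · have ha := sub_ne_zero.mpr hwz
    have hb := sub_ne_zero.mpr hwz₀
    have ha' := norm_pos_iff.mpr ha
    have hb' := norm_pos_iff.mpr hb
    have hd : ‖z - z₀‖ ≤ ‖w - z‖ + ‖w - z₀‖ := by
      rw [norm_sub_rev w z]
      simpa using norm_add_le (z - w) (w - z₀)
    have e : (w - z)⁻¹ - (w - z₀)⁻¹ - (z - z₀) * (w - z₀)⁻¹ ^ 2 =
        (z - z₀) ^ 2 / ((w - z) * (w - z₀) ^ 2) := by
      field_simp
      ring
    rw [e, truncatedKernel_sub α hw hz, truncatedKernel_sub α hw hz₀]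
    calc _ ≤ (1 + ‖J‖) * (‖(z - z₀) ^ 2 / ((w - z) * (w - z₀) ^ 2)‖ * ‖v‖) :=
          norm_complexAct_le J _ _
      _ ≤ (1 + ‖J‖) * (‖(z - z₀) ^ 2 / ((w - z) * (w - z₀) ^ 2)‖ * (K * ‖w - z₀‖)) := by gcongr
      _ = (1 + ‖J‖) * K * (‖z - z₀‖ ^ 2 / (‖w - z‖ * ‖w - z₀‖)) := by
        simp only [norm_div, norm_mul, norm_pow]
        field_simp
      _ ≤ (1 + ‖J‖) * K * (2 * ‖z - z₀‖ ^ (1 + α) *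
          (‖w - z‖ ^ (-(1 + α)) + ‖w - z₀‖ ^ (-(1 + α)))) := by
        gcongr
        exact sq_div_mul_le hα₀ hα₁ ha' hb' (norm_nonneg _) hd
      _ = _ := by ring
  · rw [hsupp hw, map_zero, norm_zero]
    have h1 := truncatedKernel_nonneg α (w - z)
    have h2 := truncatedKernel_nonneg α (w - z₀)
    positivity

variable [CompleteSpace E]

/-- Expand the kernel of the Cauchy-Pompeiu formula to first order in `z` at `z₀`. The linear
coefficient involves `(w - z₀)⁻¹ ^ 2`, integrable only because `hbar` makes the density vanish at
`z₀`. -/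
theorem exists_norm_sub_complexAct_le {α : ℝ} (hα₀ : 0 < α) (hα₁ : α < 1) {J : E →L[ℝ] E}
    (hJ : ∀ v, J (J v) = -v) {h : ℂ → E} (hh : ContDiff ℝ 1 h) (hs : HasCompactSupport h)
    (hsub : tsupport h ⊆ Metric.ball 0 1) {z₀ : ℂ} (hz₀ : z₀ ∈ Metric.ball (0 : ℂ) 1) {K : ℝ}
    (hK : 0 ≤ K) (hbar : ∀ w ∈ Metric.ball (0 : ℂ) 1, ‖dbarOp J h w‖ ≤ K * ‖w - z₀‖) :
    ∃ A : E, ∀ z ∈ Metric.ball (0 : ℂ) 1, ‖h z - h z₀ - complexAct J (z - z₀) A‖ ≤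
      (1 + ‖J‖) * K * (∫ x, truncatedKernel α x) * ‖z - z₀‖ ^ (1 + α) := by
  have he := continuous_dbarOp J hh
  have hsupp (w : ℂ) (hw : w ∉ Metric.ball (0 : ℂ) 1) : dbarOp J h w = 0 :=
    dbarOp_eq_zero_of_notMem_tsupport J fun hm => hw (hsub hm)
  have hcauchy (z : ℂ) (hz : z ∈ Metric.ball (0 : ℂ) 1) :
      Integrable fun w => complexAct J (w - z)⁻¹ (dbarOp J h w) := by
    refine integrable_complexAct_of_norm_le hα₀ hα₁ J (by fun_prop) he hsupp hz (B := K * 2)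
      (fun w hw => ?_) (by positivity)
    rw [norm_inv, mul_comm]
    gcongr
    refine (hbar w hw).trans ?_
    gcongr
    rw [mem_ball_zero_iff] at *
    linarith [norm_sub_le w z₀]
  have hsq : Integrable fun w => complexAct J ((w - z₀)⁻¹ ^ 2) (dbarOp J h w) := by
    refine integrable_complexAct_of_norm_le hα₀ hα₁ J (by fun_prop) he hsupp hz₀ (B := K)
      (fun w hw => ?_) hK
    rcases eq_or_ne w z₀ with rfl | hne
    · simp
    have hp : 0 < ‖w - z₀‖ := norm_pos_iff.mpr (sub_ne_zero.mpr hne)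
    calc _ ≤ ‖(w - z₀)⁻¹ ^ 2‖ * (K * ‖w - z₀‖) := by gcongr; exact hbar w hw
      _ = K * ‖w - z₀‖⁻¹ := by
        rw [norm_pow, norm_inv]
        field_simp
  set T := ∫ w, complexAct J ((w - z₀)⁻¹ ^ 2) (dbarOp J h w) with hT
  -- Formal complex derivative of the Cauchy integral at `z₀`.
  refine ⟨-((2 * Real.pi)⁻¹ • T), fun z hz => ?_⟩
  have hpi : (2 * Real.pi) ≠ 0 := by positivity
  have key : (2 * Real.pi) • (h z - h z₀ - complexAct J (z - z₀) (-((2 * Real.pi)⁻¹ • T))) =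
      -∫ w, complexAct J ((w - z)⁻¹ - (w - z₀)⁻¹ - (z - z₀) * (w - z₀)⁻¹ ^ 2) (dbarOp J h w) := by
    have h3 : ∫ w, complexAct J (z - z₀) (complexAct J ((w - z₀)⁻¹ ^ 2) (dbarOp J h w)) =
        complexAct J (z - z₀) T := (complexAct J (z - z₀)).integral_comp_comm hsq
    simp only [complexAct_sub J (_ - _ : ℂ), complexAct_sub J (_⁻¹ : ℂ), complexAct_mul hJ]
    have hdiff : Integrable fun w => complexAct J (w - z)⁻¹ (dbarOp J h w) -
        complexAct J (w - z₀)⁻¹ (dbarOp J h w) := (hcauchy z hz).sub (hcauchy z₀ hz₀)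
    rw [integral_sub hdiff
      ((complexAct J (z - z₀)).integrable_comp hsq), integral_sub (hcauchy z hz) (hcauchy z₀ hz₀),
      h3, integral_complexAct_inv_sub_dbarOp hJ hh hs, integral_complexAct_inv_sub_dbarOp hJ hh hs]
    simp only [map_neg, map_smul, smul_sub, smul_neg, smul_smul, mul_inv_cancel₀ hpi, one_smul]
    abel
  have hkz := (integrable_truncatedKernel hα₁).comp_sub_right z
  have hkz₀ := (integrable_truncatedKernel hα₁).comp_sub_right z₀
  have hbound : ‖∫ w, complexAct J ((w - z)⁻¹ - (w - z₀)⁻¹ - (z - z₀) * (w - z₀)⁻¹ ^ 2)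
      (dbarOp J h w)‖ ≤
      4 * ((1 + ‖J‖) * K * (∫ x, truncatedKernel α x) * ‖z - z₀‖ ^ (1 + α)) := by
    calc _ ≤ ∫ w, 2 * (1 + ‖J‖) * K * ‖z - z₀‖ ^ (1 + α) *
          (truncatedKernel α (w - z) + truncatedKernel α (w - z₀)) := by
          refine norm_integral_le_of_norm_le ((hkz.add hkz₀).const_mul _) ?_
          filter_upwards [Measure.ae_ne volume z, Measure.ae_ne volume z₀] with w h1 h2
          by_cases hw : w ∈ Metric.ball (0 : ℂ) 1
          · exact norm_complexAct_kernel_le hα₀ hα₁ hz hz₀ h1 h2 (hbar w hw) hK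
              fun hn => absurd hw hn
          · exact norm_complexAct_kernel_le hα₀ hα₁ hz hz₀ h1 h2
              (by rw [hsupp w hw, norm_zero]; positivity) hK fun _ => hsupp w hw
      _ = _ := by
        rw [integral_const_mul, integral_add hkz hkz₀, integral_sub_right_eq_self,
          integral_sub_right_eq_self]
        ring
  -- The factor `4` in `hbound` is absorbed by the `2π` of the Cauchy formula.
  have h4 : (4 : ℝ) ≤ 2 * Real.pi := by linarith [Real.pi_gt_three]
  have hnorm := congrArg norm key
  rw [norm_neg, norm_smul, Real.norm_of_nonneg (by positivity)] at hnorm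
  have := norm_nonneg (h z - h z₀ - complexAct J (z - z₀) (-((2 * Real.pi)⁻¹ • T)))
  nlinarith

theorem hasFDerivAt_of_norm_sub_le_rpow {F : Type*} [NormedAddCommGroup F] [NormedSpace ℝ F]
    {h : ℂ → F} {z₀ : ℂ} {L : ℂ →L[ℝ] F} {α D : ℝ} (hα₀ : 0 < α)
    (hL : ∀ᶠ z in 𝓝 z₀, ‖h z - h z₀ - L (z - z₀)‖ ≤ D * ‖z - z₀‖ ^ (1 + α)) :
    HasFDerivAt h L z₀ := by
  rw [hasFDerivAt_iff_isLittleO, Asymptotics.isLittleO_iff]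
  intro c hc
  have ht : Tendsto (fun z => D * ‖z - z₀‖ ^ α) (𝓝 z₀) (𝓝 0) := by
    have : Continuous fun z => D * ‖z - z₀‖ ^ α := by
      have := hα₀.le
      fun_prop (disch := assumption)
    simpa [Real.zero_rpow hα₀.ne'] using this.tendsto z₀
  filter_upwards [hL, ht.eventually_le_const hc] with z h1 h2
  calc _ ≤ _ := h1
    _ = D * ‖z - z₀‖ ^ α * ‖z - z₀‖ := by
      rw [Real.rpow_one_add' (norm_nonneg _) (by linarith)]
      ring
    _ ≤ _ := by gcongr

theorem norm_sub_fderiv_le {α : ℝ} (hα₀ : 0 < α) (hα₁ : α < 1) {J : E →L[ℝ] E}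
    (hJ : ∀ v, J (J v) = -v) {h : ℂ → E} (hh : ContDiff ℝ 1 h) (hs : HasCompactSupport h)
    (hsub : tsupport h ⊆ Metric.ball 0 1) {z₀ : ℂ} (hz₀ : z₀ ∈ Metric.ball (0 : ℂ) 1) {K : ℝ}
    (hK : 0 ≤ K) (hbar : ∀ w ∈ Metric.ball (0 : ℂ) 1, ‖dbarOp J h w‖ ≤ K * ‖w - z₀‖)
    {z : ℂ} (hz : z ∈ Metric.ball (0 : ℂ) 1) :
    ‖h z - h z₀ - fderiv ℝ h z₀ (z - z₀)‖ ≤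
      (1 + ‖J‖) * K * (∫ x, truncatedKernel α x) * ‖z - z₀‖ ^ (1 + α) := by
  obtain ⟨A, hA⟩ := exists_norm_sub_complexAct_le hα₀ hα₁ hJ hh hs hsub hz₀ hK hbar
  have hd : HasFDerivAt h (Complex.reCLM.smulRight A + Complex.imCLM.smulRight (J A)) z₀ :=
    hasFDerivAt_of_norm_sub_le_rpow hα₀
      (eventually_of_mem (Metric.isOpen_ball.mem_nhds hz₀) fun z hz => hA z hz)
  rw [hd.fderiv]
  exact hA z hz

end Singular

/-! ### From Taylor expansions to the Hölder bound on concentric disks. -/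

section Holder

variable {E : Type*} [NormedAddCommGroup E] [NormedSpace ℝ E]

/-- For `‖v‖ = d = ‖z₁ - z₀‖`, the difference of differentials applied to `v` is a combination of
three Taylor remainders, over distances at most `2 * d`, `d` and `d`. As `2 ^ (1 + α) ≤ 4`, the
constant is `4 + 1 + 1 = 6`. -/
theorem norm_fderiv_sub_le_of_taylor {f : ℂ → E} {α D R δ : ℝ} (hα₀ : 0 < α) (hα₁ : α < 1)
    (hD : 0 ≤ D)
    (hf : ∀ z₀ ∈ Metric.closedBall (0 : ℂ) R, ∀ z ∈ Metric.closedBall (0 : ℂ) (R + δ),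
      ‖f z - f z₀ - fderiv ℝ f z₀ (z - z₀)‖ ≤ D * ‖z - z₀‖ ^ (1 + α))
    {z₀ z₁ : ℂ} (hz₀ : z₀ ∈ Metric.closedBall (0 : ℂ) R) (hz₁ : z₁ ∈ Metric.closedBall (0 : ℂ) R)
    (hδ : ‖z₁ - z₀‖ ≤ δ) :
    ‖fderiv ℝ f z₁ - fderiv ℝ f z₀‖ ≤ 6 * D * ‖z₁ - z₀‖ ^ α := by
  rcases eq_or_ne z₁ z₀ with rfl | hne
  · simp [Real.zero_rpow hα₀.ne']
  set d := ‖z₁ - z₀‖ with hd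
  have hd0 : 0 < d := norm_pos_iff.mpr (sub_ne_zero.mpr hne)
  have hdpow : d ^ (1 + α) = d * d ^ α := Real.rpow_one_add' hd0.le (by linarith)
  have hsphere (v : ℂ) (hv : ‖v‖ = d) :
      ‖(fderiv ℝ f z₁ - fderiv ℝ f z₀) v‖ ≤ 6 * D * d ^ α * ‖v‖ := by
    have hmem : z₁ + v ∈ Metric.closedBall (0 : ℂ) (R + δ) := by
      rw [mem_closedBall_zero_iff] at *
      linarith [norm_add_le z₁ v]
    have hmem₁ : z₁ ∈ Metric.closedBall (0 : ℂ) (R + δ) := by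
      rw [mem_closedBall_zero_iff] at *
      linarith
    have t1 := hf z₁ hz₁ (z₁ + v) hmem
    have t2 := hf z₀ hz₀ (z₁ + v) hmem
    have t3 := hf z₀ hz₀ z₁ hmem₁
    have h2d : ‖z₁ + v - z₀‖ ≤ 2 * d := by
      rw [add_sub_right_comm]
      linarith [norm_add_le (z₁ - z₀) v]
    have h4 : ‖z₁ + v - z₀‖ ^ (1 + α) ≤ 4 * d ^ (1 + α) := by
      calc _ ≤ (2 * d) ^ (1 + α) := by gcongr
        _ = 2 ^ (1 + α) * d ^ (1 + α) := Real.mul_rpow (by norm_num) hd0.le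
        _ ≤ 2 ^ (2 : ℝ) * d ^ (1 + α) := by
          gcongr
          · norm_num
          · linarith
        _ = _ := by norm_num
    have e : (fderiv ℝ f z₁ - fderiv ℝ f z₀) v =
        (f (z₁ + v) - f z₀ - fderiv ℝ f z₀ (z₁ + v - z₀)) -
        (f (z₁ + v) - f z₁ - fderiv ℝ f z₁ (z₁ + v - z₁)) -
        (f z₁ - f z₀ - fderiv ℝ f z₀ (z₁ - z₀)) := by
      simp only [sub_apply, map_sub, map_add]
      abel
    rw [add_sub_cancel_left, hv] at t1
    rw [← hd] at t3
    rw [e, add_sub_cancel_left, hv]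
    calc _ ≤ D * (4 * d ^ (1 + α)) + D * d ^ (1 + α) + D * d ^ (1 + α) := by
          refine norm_sub_le_of_le (norm_sub_le_of_le (t2.trans ?_) t1) t3
          gcongr
      _ = _ := by rw [hdpow]; ring
  refine ContinuousLinearMap.opNorm_le_of_unit_norm (by positivity) fun u hu => ?_
  have h1 := hsphere (d • u) (by rw [norm_smul, hu, mul_one, Real.norm_of_nonneg hd0.le])
  rw [map_smul, norm_smul, norm_smul, hu, Real.norm_of_nonneg hd0.le] at h1
  refine le_of_mul_le_mul_left ?_ hd0
  linarith

theorem dbarOp_smul_sub {J : E →L[ℝ] E} {χ : ℂ → ℝ} {f : ℂ → E} {w : ℂ} (y : E)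
    (hχ : DifferentiableAt ℝ χ w) (hf : DifferentiableAt ℝ f w) :
    dbarOp J (fun w => χ w • (f w - y)) w = χ w • dbarOp J f w +
      (fderiv ℝ χ w 1 • (f w - y) + fderiv ℝ χ w Complex.I • J (f w - y)) := by
  have h : fderiv ℝ (fun w => χ w • (f w - y)) w = _ :=
    (hχ.hasFDerivAt.smul (hf.hasFDerivAt.sub_const y)).fderiv
  unfold dbarOp
  rw [h]
  simp only [add_apply, smul_apply, ContinuousLinearMap.smulRight_apply, map_add, map_smul]
  module

/-- By `hw`, the defect equals `J y` applied to `(J (f w) - J y) (Df 1)`. -/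
theorem norm_dbarOp_frozen_le {J : E → E →L[ℝ] E} (hJ : ∀ y v, J y (J y v) = -v) {f : ℂ → E}
    {w : ℂ} (hw : ∀ v : ℂ, fderiv ℝ f w (Complex.I * v) = J (f w) (fderiv ℝ f w v)) (y : E) :
    ‖dbarOp (J y) f w‖ ≤ ‖J y‖ * (‖J (f w) - J y‖ * ‖fderiv ℝ f w‖) := by
  have h1 : dbarOp (J y) f w = J y ((J (f w) - J y) (fderiv ℝ f w 1)) := by
    have := hw 1
    rw [mul_one] at this
    rw [dbarOp, this, sub_apply, map_sub, hJ]
    abel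
  rw [h1]
  refine (J y).le_opNorm_of_le ((J (f w) - J y).le_opNorm_of_le ?_)
  simpa using (fderiv ℝ f w).le_opNorm 1

theorem contDiff_smul_sub {χ : ContDiffBump (0 : ℂ)} (hχ : χ.rOut < 1) {f : ℂ → E}
    (hf : ContDiffOn ℝ 1 f (Metric.ball 0 1)) (y : E) :
    ContDiff ℝ 1 fun w => χ w • (f w - y) := by
  rw [contDiff_iff_contDiffAt]
  intro w
  by_cases hw : w ∈ Metric.ball (0 : ℂ) 1
  · exact χ.contDiffAt.smul
      ((hf.contDiffAt (Metric.isOpen_ball.mem_nhds hw)).sub contDiffAt_const)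
  · have h0 : (χ : ℂ → ℝ) =ᶠ[𝓝 w] 0 := by
      rw [← notMem_tsupport_iff_eventuallyEq, χ.tsupport_eq]
      exact fun hm => hw (Metric.closedBall_subset_ball hχ hm)
    refine contDiffAt_const (c := (0 : E)) |>.congr_of_eventuallyEq ?_
    filter_upwards [h0] with x hx
    simp [hx]

theorem exists_norm_fderiv_bump_le (χ : ContDiffBump (0 : ℂ)) :
    ∃ B : ℝ, 0 ≤ B ∧ ∀ w, ‖fderiv ℝ χ w‖ ≤ B := by
  obtain ⟨B, hB⟩ := ((χ.contDiff (n := 1)).continuous_fderiv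
    one_ne_zero).bounded_above_of_compact_support (χ.hasCompactSupport.fderiv ℝ)
  exact ⟨B, (norm_nonneg _).trans (hB 0), hB⟩

theorem norm_sub_le_of_fderiv_bound {F : Type*} [NormedAddCommGroup F] [NormedSpace ℝ F]
    {g : ℂ → F} {M : ℝ}
    (hg : ∀ z ∈ Metric.ball (0 : ℂ) 1, DifferentiableAt ℝ g z)
    (hM : ∀ z ∈ Metric.ball (0 : ℂ) 1, ‖fderiv ℝ g z‖ ≤ M) {z w : ℂ}
    (hz : z ∈ Metric.ball (0 : ℂ) 1) (hw : w ∈ Metric.ball (0 : ℂ) 1) :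
    ‖g w - g z‖ ≤ M * ‖w - z‖ :=
  (convex_ball 0 1).norm_image_sub_le_of_norm_fderiv_le hg hM hz hw

variable [CompleteSpace E]

theorem exists_taylor_bound {α : ℝ} (hα₀ : 0 < α) (hα₁ : α < 1) {Λ : ℝ} (hΛ : 0 ≤ Λ)
    (χ : ContDiffBump (0 : ℂ)) (hχ : χ.rOut < 1) :
    ∃ C : ℝ, 0 ≤ C ∧ ∀ (J : E → E →L[ℝ] E) (f : ℂ → E) (M s : ℝ),
      Differentiable ℝ J → (∀ y v, J y (J y v) = -v) →
      ContDiffOn ℝ 1 f (Metric.ball 0 1) →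
      (∀ z ∈ Metric.ball (0 : ℂ) 1, ∀ v : ℂ,
        fderiv ℝ f z (Complex.I * v) = J (f z) (fderiv ℝ f z v)) →
      (∀ z ∈ Metric.ball (0 : ℂ) 1, ‖J (f z)‖ ≤ Λ ∧ ‖fderiv ℝ J (f z)‖ ≤ Λ) →
      (∀ z ∈ Metric.ball (0 : ℂ) 1, ‖fderiv ℝ f z‖ ≤ M) → M ≤ s → M ^ 2 ≤ s →
      ∀ z₀ ∈ Metric.ball (0 : ℂ) χ.rIn, ∀ z ∈ Metric.closedBall (0 : ℂ) χ.rIn,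
        ‖f z - f z₀ - fderiv ℝ f z₀ (z - z₀)‖ ≤ C * s * ‖z - z₀‖ ^ (1 + α) := by
  obtain ⟨B, hB0, hB⟩ := exists_norm_fderiv_bump_le χ
  have hI : 0 ≤ ∫ x, truncatedKernel α x :=
    integral_nonneg fun x => truncatedKernel_nonneg α x
  refine ⟨(1 + Λ) * (Λ ^ 2 + B * (1 + Λ)) * ∫ x, truncatedKernel α x, by positivity, ?_⟩
  intro J f M s hJd hJ hf hhol hbd hM hMs hMs2 z₀ hz₀ z hz
  have hin : χ.rIn < 1 := χ.rIn_lt_rOut.trans hχ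
  have hz₀1 : z₀ ∈ Metric.ball (0 : ℂ) 1 := Metric.ball_subset_ball hin.le hz₀
  have hz1 : z ∈ Metric.ball (0 : ℂ) 1 := Metric.closedBall_subset_ball hin hz
  have hM0 : 0 ≤ M := (norm_nonneg _).trans (hM z₀ hz₀1)
  have hs0 : 0 ≤ s := hM0.trans hMs
  have hfd (w : ℂ) (hw : w ∈ Metric.ball (0 : ℂ) 1) : DifferentiableAt ℝ f w :=
    (hf.contDiffAt (Metric.isOpen_ball.mem_nhds hw)).differentiableAt one_ne_zero
  have hfl (w : ℂ) (hw : w ∈ Metric.ball (0 : ℂ) 1) : ‖f w - f z₀‖ ≤ M * ‖w - z₀‖ :=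
    norm_sub_le_of_fderiv_bound hfd hM hz₀1 hw
  have hJl (w : ℂ) (hw : w ∈ Metric.ball (0 : ℂ) 1) :
      ‖J (f w) - J (f z₀)‖ ≤ Λ * M * ‖w - z₀‖ := by
    refine norm_sub_le_of_fderiv_bound (g := fun z => J (f z))
      (fun w hw => (hJd _).comp w (hfd w hw)) (fun w hw => ?_) hz₀1 hw
    rw [fderiv_fun_comp w (hJd (f w)) (hfd w hw)]
    refine (ContinuousLinearMap.opNorm_comp_le _ _).trans ?_
    gcongr
    exacts [(hbd w hw).2, hM w hw]
  have hJ0 := (hbd z₀ hz₀1).1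
  -- Subtracting `f z₀` makes the terms where the derivative falls on the cutoff vanish linearly at
  -- `z₀` too.
  set h : ℂ → E := fun w => χ w • (f w - f z₀) with hh
  have hsupp : tsupport h ⊆ Metric.closedBall 0 χ.rOut := by
    rw [← χ.tsupport_eq]
    exact closure_mono fun w hw hw0 => hw (by simp [hh, hw0])
  have hcs : HasCompactSupport h :=
    (isCompact_closedBall _ _).of_isClosed_subset (isClosed_tsupport _) hsupp
  have hbar (w : ℂ) (hw : w ∈ Metric.ball (0 : ℂ) 1) :
      ‖dbarOp (J (f z₀)) h w‖ ≤ (Λ ^ 2 + B * (1 + Λ)) * s * ‖w - z₀‖ := by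
    rw [hh, dbarOp_smul_sub _ (χ.contDiff (n := 1) |>.differentiable one_ne_zero w) (hfd w hw)]
    have h1 : ‖χ w • dbarOp (J (f z₀)) f w‖ ≤ Λ * (Λ * M * ‖w - z₀‖ * M) := by
      rw [norm_smul, Real.norm_of_nonneg χ.nonneg]
      refine (mul_le_of_le_one_left (norm_nonneg _) χ.le_one).trans ?_
      refine (norm_dbarOp_frozen_le hJ (hhol w hw) _).trans ?_
      gcongr
      exacts [hJl w hw, hM w hw]
    have h2 : ‖fderiv ℝ χ w 1 • (f w - f z₀)‖ ≤ B * (M * ‖w - z₀‖) := by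
      rw [norm_smul]
      gcongr
      · simpa using (fderiv ℝ χ w).le_of_opNorm_le (hB w) 1
      · exact hfl w hw
    have h3 : ‖fderiv ℝ χ w Complex.I • J (f z₀) (f w - f z₀)‖ ≤ B * (Λ * (M * ‖w - z₀‖)) := by
      rw [norm_smul]
      gcongr
      · simpa using (fderiv ℝ χ w).le_of_opNorm_le (hB w) Complex.I
      · exact ((J (f z₀)).le_of_opNorm_le hJ0 _).trans (by gcongr; exact hfl w hw)
    calc _ ≤ Λ * (Λ * M * ‖w - z₀‖ * M) + (B * (M * ‖w - z₀‖) + B * (Λ * (M * ‖w - z₀‖))) :=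
          norm_add_le_of_le h1 (norm_add_le_of_le h2 h3)
      _ = (Λ ^ 2 * M ^ 2 + B * (1 + Λ) * M) * ‖w - z₀‖ := by ring
      _ ≤ (Λ ^ 2 * s + B * (1 + Λ) * s) * ‖w - z₀‖ := by gcongr
      _ = _ := by ring
  have key := norm_sub_fderiv_le hα₀ hα₁ (hJ (f z₀)) (contDiff_smul_sub hχ hf (f z₀)) hcs
    (hsupp.trans (Metric.closedBall_subset_ball hχ)) hz₀1 (by positivity) hbar hz1
  have hev : h =ᶠ[𝓝 z₀] fun w => f w - f z₀ := by
    filter_upwards [χ.eventuallyEq_one_of_mem_ball hz₀] with w hw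
    simp [hh, hw]
  have hfe : fderiv ℝ h z₀ = fderiv ℝ f z₀ := by
    rw [hev.fderiv_eq, fderiv_sub_const]
  have hhz : h z - h z₀ = f z - f z₀ := by
    simp [hh, χ.one_of_mem_closedBall hz]
  change ‖h z - h z₀ - fderiv ℝ h z₀ (z - z₀)‖ ≤ _ at key
  rw [hfe, hhz] at key
  refine key.trans ?_
  calc _ ≤ (1 + Λ) * ((Λ ^ 2 + B * (1 + Λ)) * s) * (∫ x, truncatedKernel α x) *
        ‖z - z₀‖ ^ (1 + α) := by gcongr
    _ = _ := by ring

theorem exists_holder_bound {α : ℝ} (hα₀ : 0 < α) (hα₁ : α < 1) {Λ : ℝ} (hΛ : 0 ≤ Λ)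
    {R : ℝ} (hR₀ : 0 ≤ R) (hR₁ : R < 1) :
    ∃ C : ℝ, 0 ≤ C ∧ ∀ (J : E → E →L[ℝ] E) (f : ℂ → E) (M s : ℝ),
      Differentiable ℝ J → (∀ y v, J y (J y v) = -v) →
      ContDiffOn ℝ 1 f (Metric.ball 0 1) →
      (∀ z ∈ Metric.ball (0 : ℂ) 1, ∀ v : ℂ,
        fderiv ℝ f z (Complex.I * v) = J (f z) (fderiv ℝ f z v)) →
      (∀ z ∈ Metric.ball (0 : ℂ) 1, ‖J (f z)‖ ≤ Λ ∧ ‖fderiv ℝ J (f z)‖ ≤ Λ) →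
      (∀ z ∈ Metric.ball (0 : ℂ) 1, ‖fderiv ℝ f z‖ ≤ M) → M ≤ s → M ^ 2 ≤ s →
      ∀ z₀ ∈ Metric.closedBall (0 : ℂ) R, ∀ z₁ ∈ Metric.closedBall (0 : ℂ) R,
        ‖fderiv ℝ f z₁ - fderiv ℝ f z₀‖ ≤ C * s * ‖z₁ - z₀‖ ^ α := by
  set δ : ℝ := (1 - R) / 3 with hδdef
  have hδ : 0 < δ := by rw [hδdef]; linarith
  -- The margin `δ` beyond `R` leaves room for the test points `z₁ + v` with `‖v‖ ≤ δ`; the support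
  -- still ends at distance `δ` from the unit circle.
  let χ : ContDiffBump (0 : ℂ) := ⟨R + δ, R + 2 * δ, by linarith, by linarith⟩
  obtain ⟨D, hD, hDt⟩ := exists_taylor_bound (E := E) hα₀ hα₁ hΛ χ
    (show R + 2 * δ < 1 by rw [hδdef]; linarith)
  refine ⟨6 * D + 2 * δ ^ (-α), by positivity, ?_⟩
  intro J f M s hJd hJ hf hhol hbd hM hMs hMs2 z₀ hz₀ z₁ hz₁
  have hball {z : ℂ} (hz : z ∈ Metric.closedBall (0 : ℂ) R) : z ∈ Metric.ball (0 : ℂ) 1 :=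
    Metric.closedBall_subset_ball hR₁ hz
  have hs0 : 0 ≤ s := (norm_nonneg _).trans ((hM z₀ (hball hz₀)).trans hMs)
  have hp : 0 ≤ ‖z₁ - z₀‖ ^ α := by positivity
  rcases le_total ‖z₁ - z₀‖ δ with hle | hle
  · have h1 := norm_fderiv_sub_le_of_taylor hα₀ hα₁ (D := D * s) (by positivity)
      (fun z₀ hz₀ z hz => hDt J f M s hJd hJ hf hhol hbd hM hMs hMs2 z₀
        (Metric.closedBall_subset_ball (show R < R + δ by linarith) hz₀) z hz) hz₀ hz₁ hle
    refine h1.trans (mul_le_mul_of_nonneg_right ?_ hp)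
    have : 0 ≤ 2 * δ ^ (-α) * s := by positivity
    linarith
  -- For distant points the trivial bound `2 * s` on the oscillation suffices.
  · have h1 : 1 ≤ δ ^ (-α) * ‖z₁ - z₀‖ ^ α := by
      calc 1 = δ ^ (-α) * δ ^ α := by rw [← Real.rpow_add hδ]; simp
        _ ≤ _ := by gcongr
    calc _ ≤ s + s := norm_sub_le_of_le ((hM z₁ (hball hz₁)).trans hMs)
          ((hM z₀ (hball hz₀)).trans hMs)
      _ ≤ 2 * s * (δ ^ (-α) * ‖z₁ - z₀‖ ^ α) := by nlinarith
      _ ≤ _ := by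
        have : 0 ≤ 6 * D * s * ‖z₁ - z₀‖ ^ α := by positivity
        linarith

end Holder

/-! ### Reduction to concentric disks and passage to `[0, ∞]`. -/

theorem norm_add_lt_one_of_closedBall_subset {c : ℂ} {r : ℝ} (hr : 0 < r)
    (h : Metric.closedBall c r ⊆ Metric.ball (0 : ℂ) 1) : ‖c‖ + r < 1 := by
  obtain ⟨u, hu, hcu⟩ : ∃ u : ℂ, ‖u‖ = 1 ∧ c = ‖c‖ • u := by
    rcases eq_or_ne c 0 with rfl | hc
    · exact ⟨1, by simp⟩
    · have hn : ‖c‖ ≠ 0 := norm_ne_zero_iff.mpr hc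
      refine ⟨‖c‖⁻¹ • c, ?_, ?_⟩
      · rw [norm_smul, norm_inv, norm_norm, inv_mul_cancel₀ hn]
      · rw [smul_smul, mul_inv_cancel₀ hn, one_smul]
  have hm : c + r • u ∈ Metric.closedBall c r := by
    rw [mem_closedBall_iff_norm, add_sub_cancel_left, norm_smul, hu, mul_one,
      Real.norm_of_nonneg hr.le]
  have h1 := h hm
  rw [mem_ball_zero_iff] at h1
  have h2 : c + r • u = (‖c‖ + r) • u := by
    rw [add_smul, ← hcu]
  rwa [h2, norm_smul, hu, mul_one, Real.norm_of_nonneg (by positivity)] at h1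

theorem mainTheorem8 (n : ℕ) (α : ℝ≥0) (hα₀ : 0 < α) (hα₁ : α < 1)
    (c : ℂ) (r : ℝ) (hr : 0 < r) (hD' : Metric.closedBall c r ⊆ Metric.ball (0 : ℂ) 1)
    (Λ : ℝ) :
    ∃ C : ℝ, 0 < C ∧
      ∀ (J : EuclideanSpace ℝ (Fin (2 * n)) →
          (EuclideanSpace ℝ (Fin (2 * n)) →L[ℝ] EuclideanSpace ℝ (Fin (2 * n))))
        (f : ℂ → EuclideanSpace ℝ (Fin (2 * n))),
        IsAlmostComplexStructure J →
        IsPseudoHolomorphicOn J f (Metric.ball 0 1) →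
        (∀ z ∈ Metric.ball (0 : ℂ) 1, ‖J (f z)‖ ≤ Λ ∧ ‖fderiv ℝ J (f z)‖ ≤ Λ) →
        holderNormOn α (fderiv ℝ f) (Metric.closedBall c r) ≤
          ENNReal.ofReal C *
            ⨆ z ∈ Metric.ball (0 : ℂ) 1, (‖fderiv ℝ f z‖ₑ + ‖fderiv ℝ f z‖ₑ ^ 2) := by
  have hR := norm_add_lt_one_of_closedBall_subset hr hD'
  have hsub : Metric.closedBall c r ⊆ Metric.closedBall 0 (‖c‖ + r) := by
    refine Metric.closedBall_subset_closedBall' ?_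
    rw [dist_zero_right, add_comm]
  obtain ⟨C, hC, hCt⟩ := exists_holder_bound (E := EuclideanSpace ℝ (Fin (2 * n)))
    (NNReal.coe_pos.mpr hα₀) (NNReal.coe_lt_one.mpr hα₁) (abs_nonneg Λ)
    (R := ‖c‖ + r) (by positivity) hR
  -- The `1` pays for the supremum part of the norm, `C` for the seminorm.
  refine ⟨1 + C, by positivity, fun J f hJ hf hbd => ?_⟩
  set S : ℝ≥0∞ := ⨆ z ∈ Metric.ball (0 : ℂ) 1, (‖fderiv ℝ f z‖ₑ + ‖fderiv ℝ f z‖ₑ ^ 2) with hS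
  have hle (z : ℂ) (hz : z ∈ Metric.ball (0 : ℂ) 1) :
      ‖fderiv ℝ f z‖ₑ + ‖fderiv ℝ f z‖ₑ ^ 2 ≤ S :=
    le_iSup₂ (f := fun z _ => ‖fderiv ℝ f z‖ₑ + ‖fderiv ℝ f z‖ₑ ^ 2) z hz
  rcases eq_or_ne S ⊤ with htop | htop
  · rw [htop, ENNReal.mul_top (by simp; positivity)]
    exact le_top
  lift S to ℝ≥0 using htop with s
  have hle' (z : ℂ) (hz : z ∈ Metric.ball (0 : ℂ) 1) :
      ‖fderiv ℝ f z‖ + ‖fderiv ℝ f z‖ ^ 2 ≤ s := by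
    have := hle z hz
    rw [enorm_eq_nnnorm] at this
    exact_mod_cast this
  -- From `x + x ^ 2 ≤ s` with `x ≥ 0` follow `x ≤ s` and `x ≤ √s`; the minimum is a bound `M` with
  -- both `M ≤ s` and `M ^ 2 ≤ s`.
  have hbound := hCt J f (min s (√s)) s (hJ.smooth.differentiable (by simp)) hJ.sq_eq_neg
    hf.contDiffOn hf.fderiv_I_mul
    (fun z hz => ⟨(hbd z hz).1.trans (le_abs_self Λ), (hbd z hz).2.trans (le_abs_self Λ)⟩)
    (fun z hz => by
      have h1 := hle' z hz
      refine le_min (by nlinarith [norm_nonneg (fderiv ℝ f z)])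
        (Real.le_sqrt_of_sq_le (by nlinarith [norm_nonneg (fderiv ℝ f z)])))
    (min_le_left _ _)
    (by
      calc (min (s : ℝ) (√(s : ℝ))) ^ 2 ≤ (√(s : ℝ)) ^ 2 := by
            gcongr
            exact min_le_right _ _
        _ = (s : ℝ) := Real.sq_sqrt s.coe_nonneg)
  rw [ENNReal.ofReal_add one_pos.le hC, ENNReal.ofReal_one, add_mul, one_mul]
  refine add_le_add ?_ ?_
  · refine iSup₂_le fun z hz => le_trans le_self_add (hle z (hD' hz))
  · have hH : HolderWith (C.toNNReal * s) α
        ((Metric.closedBall c r).domRestrict (fderiv ℝ f)) := by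
      rintro ⟨x, hx⟩ ⟨y, hy⟩
      have := hbound y (hsub hy) x (hsub hx)
      change edist (fderiv ℝ f x) (fderiv ℝ f y) ≤ _ * edist x y ^ (α : ℝ)
      rw [edist_eq_enorm_sub, edist_eq_enorm_sub, ← ofReal_norm, ← ofReal_norm,
        ENNReal.ofReal_rpow_of_nonneg (norm_nonneg _) α.coe_nonneg]
      refine (ENNReal.ofReal_le_ofReal this).trans (le_of_eq ?_)
      rw [ENNReal.ofReal_mul (by positivity), ENNReal.ofReal_mul hC, ENNReal.coe_mul,
        ENNReal.ofReal_coe_nnreal]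
      rfl
    exact hH.eHolderNorm_le.trans (le_of_eq (ENNReal.coe_mul _ _))
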